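/- Let $\mathfrak g$ be a finite-dimensional real simple Lie algebra with Cartan involution $\theta$, let $\mathfrak a$ be a maximal abelian subspace of $\mathfrak p=\{X\in\mathfrak g:\theta X=-X\}$, let $\Sigma$ be the set of restricted roots of $(\mathfrak g,\mathfrak a)$ with root spaces $\mathfrak g_\alpha$, and fix an ordering of $\mathfrak a^*$, with positive roots $\Sigma_+$, negative roots $\Sigma_-$ and simple roots $\Delta$. Put $\mathfrak n=\sum_{\alpha\in\Sigma_+}\mathfrak g_\alpha$ and $\overline{\mathfrak n}=\theta(\mathfrak n)$. For $\alpha=\sum_{\delta\in\Delta}n_\delta(\alpha)\delta$ in $\Sigma_+$ let $\mathcal Y(\alpha)=\{\delta\in\Delta:n_\delta(\alpha)\neq0\}$ be its simple support, and write $\alpha\preceq\beta$ if $n_\delta(\alpha)\le n_\delta(\beta)$ for all $\delta\in\Delta$. Let $\mathcal R\subseteq\Sigma_+$ be of Hessenberg type, i.e. if $\alpha\in\mathcal R$, $\beta\in\Sigma_-$ and $\alpha+\beta\in\Sigma_+$, then $\alpha+\beta\in\mathcal R$; assume $\Delta\subseteq\mathcal R$. A root $\mu\in\mathcal R$ is called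 maximal if $\mu+\alpha\notin\mathcal R$ for every $\alpha\in\Sigma_+$, and its shadow is $\mathcal S_\mu=\{\alpha\in\mathcal R:\alpha\preceq\mu\}$. Assume that for every maximal root $\mu$ the space $\sum_{\alpha\in\mathcal S_\mu}\mathfrak g_\alpha$ is a Lie subalgebra of $\mathfrak n$. A simple root $\delta$ is called a boundary simple root if there is a maximal root $\nu\in\mathcal R$ with $\delta\notin\mathcal Y(\nu)$ such that $\delta+\delta'$ is a root for some $\delta'\in\mathcal Y(\nu)$; let $\mathcal B$ be the set of boundary simple roots. Let $\mathcal C=\Sigma_+\setminus\mathcal R$, $\mathfrak n_{\mathcal C}=\sum_{\alpha\in\mathcal C}\mathfrak g_\alpha$, and let $\mathfrak q=\{X\in\mathfrak g:[X,Y]\in\mathfrak n_{\mathcal C}\text{ for all }Y\in\mathfrak n_{\mathcal C}\}$ be the normalizer of $\mathfrak n_{\mathcal C}$. Then there is a set $\mathcal D\subseteq\Sigma_-$ with $\mathfrak q\cap\overline{\mathfrak n}=\sum_{\alpha\in\mathcal D}\mathfrak g_\alpha$, and for every such $\mathcal D$: (i) if $\delta\in\Delta$, then $-\delta\notin\mathcal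 D$ if and only if $\delta\in\mathcal B$; (ii) if $\alpha\in\Sigma_+$, then $-\alpha\notin\mathcal D$ if and only if $\mathcal Y(\alpha)\cap\mathcal B\neq\emptyset$. -/

import Mathlib

namespace HessenbergLie

section

variable {g : Type*} [LieRing g] [LieAlgebra ℝ g]

/-- A Cartan involution of a real Lie algebra: an involutive automorphism `θ` for which
`(X, Y) ↦ -B(X, θ Y)` is positive definite, where `B` is the Killing form. -/
structure IsCartanInvolution (θ : g ≃ₗ⁅ℝ⁆ g) : Prop where
  involutive : ∀ X : g, θ (θ X) = X
  pos_def : ∀ X : g, X ≠ 0 → 0 < -(killingForm ℝ g X (θ X))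

/-- `a` is a maximal abelian subspace of `p = {X : θ X = -X}`. -/
structure IsMaximalAbelian (θ : g ≃ₗ⁅ℝ⁆ g) (a : Submodule ℝ g) : Prop where
  le_p : ∀ X ∈ a, θ X = -X
  abelian : ∀ X ∈ a, ∀ Y ∈ a, ⁅X, Y⁆ = 0
  maximal : ∀ b : Submodule ℝ g, (∀ X ∈ b, θ X = -X) → (∀ X ∈ b, ∀ Y ∈ b, ⁅X, Y⁆ = 0) →
    a ≤ b → b = a

/-- The space `g_α = {X : [H, X] = α(H) X for all H ∈ a}`, for `α` in the dual of `a`. -/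
def rootSpace (a : Submodule ℝ g) (α : Module.Dual ℝ a) : Submodule ℝ g where
  carrier := {X | ∀ H : a, ⁅(H : g), X⁆ = α H • X}
  add_mem' := by
    intro X Y hX hY H
    rw [lie_add, hX H, hY H, smul_add]
  zero_mem' := by
    intro H
    rw [lie_zero, smul_zero]
  smul_mem' := by
    intro c X hX H
    rw [lie_smul, hX H, smul_comm]

/-- The set `Σ` of restricted roots. -/
def roots (a : Submodule ℝ g) : Set (Module.Dual ℝ a) :=
  {α | α ≠ 0 ∧ rootSpace a α ≠ ⊥}

/-- A notion of positivity on a real vector space, given by the set `P` of positive vectors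
(equivalently, a compatible total ordering). -/
structure IsPositivity {V : Type*} [AddCommGroup V] [Module ℝ V] (P : Set V) : Prop where
  zero_notMem : (0 : V) ∉ P
  mem_or_neg_mem : ∀ v : V, v ≠ 0 → v ∈ P ∨ -v ∈ P
  add_mem : ∀ v ∈ P, ∀ w ∈ P, v + w ∈ P
  smul_mem : ∀ c : ℝ, 0 < c → ∀ v ∈ P, c • v ∈ P

/-- The positive roots `Σ₊`. -/
def posRoots (a : Submodule ℝ g) (P : Set (Module.Dual ℝ a)) : Set (Module.Dual ℝ a) :=
  {α | α ∈ roots a ∧ α ∈ P}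

/-- The negative roots `Σ₋`. -/
def negRoots (a : Submodule ℝ g) (P : Set (Module.Dual ℝ a)) : Set (Module.Dual ℝ a) :=
  {α | α ∈ roots a ∧ -α ∈ P}

/-- The simple roots `Δ`: positive roots that are not a sum of two positive roots. -/
def simpleRoots (a : Submodule ℝ g) (P : Set (Module.Dual ℝ a)) : Set (Module.Dual ℝ a) :=
  {δ | δ ∈ posRoots a P ∧ ∀ β ∈ posRoots a P, ∀ γ ∈ posRoots a P, δ ≠ β + γ}

/-- `n` is the family of integer coefficients of `α` in terms of the simple roots:
`α = ∑ n_δ δ`. -/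
def IsExpansion (a : Submodule ℝ g) (P : Set (Module.Dual ℝ a)) (α : Module.Dual ℝ a)
    (n : simpleRoots a P →₀ ℤ) : Prop :=
  α = n.sum fun δ k => k • (δ : Module.Dual ℝ a)

/-- `α ⪯ β`: coefficientwise comparison with respect to the simple roots. -/
def RootLE (a : Submodule ℝ g) (P : Set (Module.Dual ℝ a)) (α β : Module.Dual ℝ a) : Prop :=
  ∃ m n : simpleRoots a P →₀ ℤ, IsExpansion a P α m ∧ IsExpansion a P β n ∧ ∀ δ, m δ ≤ n δ

/-- The simple support `Y(α)`: the simple roots with nonzero coefficient in `α`. -/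
def simpleSupport (a : Submodule ℝ g) (P : Set (Module.Dual ℝ a)) (α : Module.Dual ℝ a) :
    Set (Module.Dual ℝ a) :=
  {δ | ∃ hδ : δ ∈ simpleRoots a P, ∃ n : simpleRoots a P →₀ ℤ,
    IsExpansion a P α n ∧ n ⟨δ, hδ⟩ ≠ 0}

/-- Subsets of `Σ₊` of Hessenberg type. -/
structure IsHessenberg (a : Submodule ℝ g) (P R : Set (Module.Dual ℝ a)) : Prop where
  subset : R ⊆ posRoots a P
  add_mem : ∀ α ∈ R, ∀ β ∈ negRoots a P, α + β ∈ posRoots a P → α + β ∈ R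

/-- The maximal roots of `R`: those `μ ∈ R` with `μ + α ∉ R` for every positive root `α`. -/
def maximalRoots (a : Submodule ℝ g) (P R : Set (Module.Dual ℝ a)) : Set (Module.Dual ℝ a) :=
  {μ | μ ∈ R ∧ ∀ α ∈ posRoots a P, μ + α ∉ R}

/-- The shadow `S_μ = {α ∈ R : α ⪯ μ}`. -/
def shadow (a : Submodule ℝ g) (P R : Set (Module.Dual ℝ a)) (μ : Module.Dual ℝ a) :
    Set (Module.Dual ℝ a) :=
  {α | α ∈ R ∧ RootLE a P α μ}

/-- The sum of the root spaces `g_α` for `α ∈ T`. -/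
def sumRootSpaces (a : Submodule ℝ g) (T : Set (Module.Dual ℝ a)) : Submodule ℝ g :=
  ⨆ α ∈ T, rootSpace a α

/-- Every shadow in `R` defines a subalgebra: for each maximal root `μ`, the space
`n^μ = ∑_{α ∈ S_μ} g_α` is closed under the Lie bracket. -/
def ShadowsAreSubalgebras (a : Submodule ℝ g) (P R : Set (Module.Dual ℝ a)) : Prop :=
  ∀ μ ∈ maximalRoots a P R, ∀ X ∈ sumRootSpaces a (shadow a P R μ),
    ∀ Y ∈ sumRootSpaces a (shadow a P R μ), ⁅X, Y⁆ ∈ sumRootSpaces a (shadow a P R μ)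

/-- The boundary simple roots `B`: simple roots `δ` outside the simple support of some maximal
root `ν` but adjacent to it, i.e. `δ + δ'` is a root for some `δ'` in that support. -/
def boundaryRoots (a : Submodule ℝ g) (P R : Set (Module.Dual ℝ a)) : Set (Module.Dual ℝ a) :=
  {δ | δ ∈ simpleRoots a P ∧ ∃ ν ∈ maximalRoots a P R, δ ∉ simpleSupport a P ν ∧
    ∃ δ' ∈ simpleSupport a P ν, δ + δ' ∈ roots a}

/-- The nilpotent Iwasawa subalgebra `n = ∑_{γ ∈ Σ₊} g_γ`. -/
def nilradical (a : Submodule ℝ g) (P : Set (Module.Dual ℝ a)) : Submodule ℝ g :=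
  sumRootSpaces a (posRoots a P)

/-- The opposite subalgebra `θ(n)`. -/
def oppNilradical (θ : g ≃ₗ⁅ℝ⁆ g) (a : Submodule ℝ g) (P : Set (Module.Dual ℝ a)) :
    Submodule ℝ g :=
  (nilradical a P).map (θ : g →ₗ[ℝ] g)

/-- The ideal `n_C = ∑_{γ ∈ C} g_γ` of `n`, where `C = Σ₊ \ R`. -/
def complementIdeal (a : Submodule ℝ g) (P R : Set (Module.Dual ℝ a)) : Submodule ℝ g :=
  sumRootSpaces a (posRoots a P \ R)

/-- The normalizer in `g` of a linear subspace `W`: all `X` with `[X, Y] ∈ W` for `Y ∈ W`. -/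
def normalizer (W : Submodule ℝ g) : LieSubalgebra ℝ g where
  carrier := {X | ∀ Y ∈ W, ⁅X, Y⁆ ∈ W}
  add_mem' := by
    intro X Z hX hZ Y hY
    rw [add_lie]
    exact W.add_mem (hX Y hY) (hZ Y hY)
  zero_mem' := by
    intro Y _
    rw [zero_lie]
    exact W.zero_mem
  smul_mem' := by
    intro c X hX Y hY
    rw [smul_lie]
    exact W.smul_mem c (hX Y hY)
  lie_mem' := by
    intro X Z hX hZ Y hY
    rw [lie_lie]
    exact W.sub_mem (hX _ (hZ Y hY)) (hZ _ (hX Y hY))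

/-- `D` is a set of negative roots with `q ∩ θ(n) = ∑_{α ∈ D} g_α`, where `q` is the normalizer
of `n_C`. -/
def IsNormalizerRootSet (θ : g ≃ₗ⁅ℝ⁆ g) (a : Submodule ℝ g) (P R D : Set (Module.Dual ℝ a)) :
    Prop :=
  D ⊆ negRoots a P ∧
    (normalizer (complementIdeal a P R)).toSubmodule ⊓ oppNilradical θ a P = sumRootSpaces a D

end

end HessenbergLie

/-! Everything rests on one norm identity for root vectors, `exists_dualForm`: for `E ∈ g_α` and `Y
∈ g_β`, the squared norms of `[E, Y]` and `[θ E, Y]` differ by `|E|² ⟨α, β⟩ |Y|²`. It replaces `sl₂`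
theory. It shows that a nonzero `E ∈ g_α` has a nonzero bracket with `g_β` as soon as `α + β` has a
nonzero space (`exists_lie_ne_zero`), it gives the sign rules for root strings, and it shows that a
subalgebra containing `g_0` and one nonzero vector of `g_α`, `α ≠ 0`, contains all of `g_α`
(`rootSpace_le_of_mem`).

Hence `q ∩ θ(n)` is a sum of root spaces. Since `q` also contains `n`, `g_{-(β+γ)} ⊆ q` exactly when
`g_{-β}` and `g_{-γ}` lie in `q`; by induction `q` is determined by the spaces `g_{-δ}` with `δ`
simple, and (ii) reduces to (i).

For (i), `g_{-δ}` fails to normalize `n_C` exactly when some `γ ∈ R` has `δ + γ ∈ C`. Take a maximal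
`ν ⪰ γ`: if `δ` were in the support of `ν`, the subalgebra attached to the shadow of `ν` would
contain a nonzero vector of `g_{δ+γ}`. So `δ` lies outside that support but is adjacent to it.
Conversely, for a boundary root, `γ = ν` itself works. -/

namespace HessenbergLie

/-! ### The norm identity for brackets of root vectors -/

section Form

variable {g : Type*} [LieRing g] [LieAlgebra ℝ g]

/-- The square of the norm attached to the inner product `(X, Y) ↦ -B(X, θ Y)`. -/
noncomputable def normSq (θ : g ≃ₗ⁅ℝ⁆ g) (X : g) : ℝ := -killingForm ℝ g X (θ X)

theorem killingForm_lie_left (X Y Z : g) :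
    killingForm ℝ g ⁅X, Y⁆ Z = killingForm ℝ g X ⁅Y, Z⁆ :=
  LieModule.traceForm_apply_lie_apply ℝ g g X Y Z

theorem killingForm_comm (X Y : g) : killingForm ℝ g X Y = killingForm ℝ g Y X :=
  LieModule.traceForm_comm ℝ g g X Y

@[simp]
theorem normSq_zero (θ : g ≃ₗ⁅ℝ⁆ g) : normSq θ (0 : g) = 0 := by
  simp [normSq]

theorem lie_mem_rootSpace {a : Submodule ℝ g} {α β : Module.Dual ℝ a} {X Y : g}
    (hX : X ∈ rootSpace a α) (hY : Y ∈ rootSpace a β) : ⁅X, Y⁆ ∈ rootSpace a (α + β) := by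
  intro H
  rw [leibniz_lie, hX H, hY H, smul_lie, lie_smul, LinearMap.add_apply, add_smul]

variable {θ : g ≃ₗ⁅ℝ⁆ g}

theorem IsCartanInvolution.normSq_pos (hθ : IsCartanInvolution θ) {X : g} (hX : X ≠ 0) :
    0 < normSq θ X :=
  hθ.pos_def X hX

theorem IsCartanInvolution.normSq_nonneg (hθ : IsCartanInvolution θ) (X : g) :
    0 ≤ normSq θ X := by
  rcases eq_or_ne X 0 with rfl | hX
  · simp
  · exact (hθ.normSq_pos hX).le

theorem IsCartanInvolution.normSq_eq_zero (hθ : IsCartanInvolution θ) {X : g} :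
    normSq θ X = 0 ↔ X = 0 := by
  refine ⟨fun h => ?_, fun h => by simp [h]⟩
  by_contra hX
  exact (hθ.normSq_pos hX).ne' h

variable {a : Submodule ℝ g}

theorem map_mem_rootSpace_neg (ha : IsMaximalAbelian θ a)
    {α : Module.Dual ℝ a} {X : g} (hX : X ∈ rootSpace a α) : θ X ∈ rootSpace a (-α) := by
  intro H
  have h := congrArg θ (hX H)
  rw [LieEquiv.map_lie, ha.le_p H H.2, neg_lie, map_smul] at h
  rw [LinearMap.neg_apply, neg_smul, ← h, neg_neg]

/-- An element of `p` that centralizes `a` lies in `a`. -/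
theorem IsMaximalAbelian.mem_of_centralizes (ha : IsMaximalAbelian θ a) {T : g}
    (hT : θ T = -T) (hTa : ∀ H ∈ a, ⁅H, T⁆ = 0) : T ∈ a := by
  have hTa' : ∀ H ∈ a, ⁅T, H⁆ = 0 := fun H hH => by rw [← lie_skew, hTa H hH, neg_zero]
  have h : a ⊔ Submodule.span ℝ {T} = a := by
    refine ha.maximal _ ?_ ?_ le_sup_left
    · intro X hX
      obtain ⟨H, hH, Y, hY, rfl⟩ := Submodule.mem_sup.mp hX
      obtain ⟨c, rfl⟩ := Submodule.mem_span_singleton.mp hY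
      rw [map_add, map_smul, hT, ha.le_p H hH, smul_neg, neg_add]
    · intro X hX X' hX'
      obtain ⟨H, hH, Y, hY, rfl⟩ := Submodule.mem_sup.mp hX
      obtain ⟨c, rfl⟩ := Submodule.mem_span_singleton.mp hY
      obtain ⟨H', hH', Y', hY', rfl⟩ := Submodule.mem_sup.mp hX'
      obtain ⟨c', rfl⟩ := Submodule.mem_span_singleton.mp hY'
      simp [ha.abelian H hH H' hH', hTa H hH, hTa' H' hH']
  rw [← h]
  exact Submodule.mem_sup_right (Submodule.mem_span_singleton_self T)

/-- The bracket is in `p` because `θ` swaps its entries, and it has weight `α - α = 0`; maximality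
of `a` does the rest. -/
theorem lie_map_mem (hθ : IsCartanInvolution θ) (ha : IsMaximalAbelian θ a)
    {α : Module.Dual ℝ a} {E : g} (hE : E ∈ rootSpace a α) : ⁅E, θ E⁆ ∈ a := by
  refine ha.mem_of_centralizes ?_ fun H hH => ?_
  · rw [LieEquiv.map_lie, hθ.involutive, lie_skew]
  · have h := lie_mem_rootSpace hE (map_mem_rootSpace_neg ha hE)
    simpa using h ⟨H, hH⟩

theorem normSq_lie (θ : g ≃ₗ⁅ℝ⁆ g) (E Y : g) :
    normSq θ ⁅E, Y⁆ = killingForm ℝ g Y ⁅E, ⁅θ E, θ Y⁆⁆ := by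
  rw [normSq, LieEquiv.map_lie, ← lie_skew E Y, map_neg, LinearMap.neg_apply, neg_neg,
    killingForm_lie_left]

/-- For the inner product `-B(·, θ ·)` the adjoint of `ad E` is `-ad (θ E)`, so only the commutator
of the two survives in the difference. -/
theorem normSq_lie_sub (hθ : IsCartanInvolution θ) (E Y : g) :
    normSq θ ⁅E, Y⁆ - normSq θ ⁅θ E, Y⁆ = killingForm ℝ g Y ⁅⁅E, θ E⁆, θ Y⁆ := by
  rw [normSq_lie, normSq_lie, hθ.involutive, lie_lie, map_sub]

/-- The inner product on the dual of `a` induced by the Killing form controls how the norms of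
`[E, Y]` and `[θ E, Y]` differ for root vectors `E` and `Y`. -/
theorem exists_dualForm [FiniteDimensional ℝ g] (hθ : IsCartanInvolution θ)
    (ha : IsMaximalAbelian θ a) :
    ∃ G : LinearMap.BilinForm ℝ (Module.Dual ℝ a),
      (∀ α β, G α β = G β α) ∧ (∀ α, α ≠ 0 → 0 < G α α) ∧
      ∀ α β : Module.Dual ℝ a, ∀ E ∈ rootSpace a α, ∀ Y ∈ rootSpace a β,
        normSq θ ⁅E, Y⁆ = normSq θ ⁅θ E, Y⁆ - normSq θ E * G α β * normSq θ Y := by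
  let F : LinearMap.BilinForm ℝ a := (killingForm ℝ g).restrict a
  have hF : ∀ H H' : a, F H H' = killingForm ℝ g H H' := fun _ _ => rfl
  have hFpos : ∀ H : a, H ≠ 0 → 0 < F H H := by
    intro H hH
    have h := hθ.pos_def H (by simpa using hH)
    rwa [ha.le_p H H.2, map_neg, neg_neg] at h
  have hFsep : ∀ H : a, (∀ H', F H H' = 0) → H = 0 := by
    intro H h
    by_contra hH
    exact (hFpos H hH).ne' (h H)
  have hFsymm : ∀ H H', F H H' = F H' H := fun H H' => killingForm_comm _ _
  have hFnd : F.Nondegenerate :=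
    ⟨hFsep, fun H h => hFsep H fun H' => by rw [hFsymm]; exact h H'⟩
  let D := (F.toDual hFnd).symm
  have hD : ∀ (α : Module.Dual ℝ a) (H : a), F (D α) H = α H := fun α H =>
    LinearMap.BilinForm.apply_toDual_symm_apply α H
  refine ⟨F.compl₁₂ (D : Module.Dual ℝ a →ₗ[ℝ] a) (D : Module.Dual ℝ a →ₗ[ℝ] a),
    fun α β => hFsymm _ _, fun α hα => hFpos _ (by simpa using hα), ?_⟩
  intro α β E hE Y hY
  have hG : (F.compl₁₂ (D : Module.Dual ℝ a →ₗ[ℝ] a) (D : Module.Dual ℝ a →ₗ[ℝ] a)) α β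
      = β (D α) := by
    change F (D α) (D β) = _
    rw [hFsymm, hD]
  let T : a := ⟨⁅E, θ E⁆, lie_map_mem hθ ha hE⟩
  -- By invariance `B(H, [E, θ E]) = B([H, E], θ E) = α(H) B(E, θ E)`, so `[E, θ E]` is a multiple
  -- of the vector dual to `α`.
  have hT : T = -(normSq θ E) • D α := by
    rw [← sub_eq_zero]
    refine hFsep _ fun H => ?_
    rw [map_sub, map_smul, LinearMap.sub_apply, LinearMap.smul_apply, hD, hFsymm, hF]
    change killingForm ℝ g (H : g) ⁅E, θ E⁆ - _ = 0
    rw [← killingForm_lie_left, hE H, map_smul, LinearMap.smul_apply, normSq, smul_eq_mul,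
      smul_eq_mul]
    ring
  have h := normSq_lie_sub hθ E Y
  have hTY : ⁅⁅E, θ E⁆, θ Y⁆ = (-β T) • θ Y := map_mem_rootSpace_neg ha hY T
  rw [hTY, hT, map_smul, map_smul] at h
  rw [hG]
  have hN : killingForm ℝ g Y (θ Y) = -normSq θ Y := by rw [normSq, neg_neg]
  rw [hN] at h
  simp only [smul_eq_mul] at h
  linarith

end Form

end HessenbergLie

namespace HessenbergLie

/-! ### Independence of root spaces and finiteness of the root set -/

section Components

variable {g : Type*} [LieRing g] [LieAlgebra ℝ g] {a : Submodule ℝ g}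

/-- A subspace stable under `ad a` contains the components of its elements. -/
theorem component_mem {W : Submodule ℝ g} (hW : ∀ H ∈ a, ∀ X ∈ W, ⁅H, X⁆ ∈ W)
    (s : Finset (Module.Dual ℝ a)) (x : Module.Dual ℝ a → g)
    (hx : ∀ α ∈ s, x α ∈ rootSpace a α) (hs : ∑ α ∈ s, x α ∈ W) : ∀ α ∈ s, x α ∈ W := by
  classical
  induction s using Finset.induction_on generalizing x with
  | empty => simp
  | insert α s hα ih =>
    have hmem : ∀ β ∈ s, x β ∈ W := by
      intro β hβ
      have hne : β - α ≠ 0 := fun h => hα (sub_eq_zero.mp h ▸ hβ)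
      obtain ⟨H, hH⟩ := DFunLike.ne_iff.mp hne
      -- The operator `ad H - α(H)` kills the `α`-component and multiplies the `γ`-component by `(γ
      -- - α)(H)`; `H` is chosen so that the factor at `β` is nonzero.
      have h := ih (fun γ => (γ - α) H • x γ)
        (fun γ hγ => Submodule.smul_mem _ _ (hx γ (Finset.mem_insert_of_mem hγ))) (by
          have h := W.sub_mem (hW H H.2 _ hs) (W.smul_mem (α H) hs)
          rw [lie_sum, Finset.smul_sum, ← Finset.sum_sub_distrib] at h
          rw [Finset.sum_insert hα, hx α (Finset.mem_insert_self _ _), sub_self, zero_add] at h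
          convert h using 1
          refine Finset.sum_congr rfl fun γ hγ => ?_
          rw [hx γ (Finset.mem_insert_of_mem hγ) H, LinearMap.sub_apply, sub_smul]) β hβ
      exact (W.smul_mem_iff hH).mp h
    intro β hβ
    rcases Finset.mem_insert.mp hβ with rfl | hβ
    · rw [Finset.sum_insert hα] at hs
      exact (W.add_mem_iff_left (W.sum_mem hmem)).mp hs
    · exact hmem β hβ

theorem rootSpace_le_sumRootSpaces {T : Set (Module.Dual ℝ a)} {α : Module.Dual ℝ a}
    (hα : α ∈ T) : rootSpace a α ≤ sumRootSpaces a T :=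
  le_biSup (rootSpace a) hα

theorem exists_components {T : Set (Module.Dual ℝ a)} {X : g} (hX : X ∈ sumRootSpaces a T) :
    ∃ (s : Finset (Module.Dual ℝ a)) (x : Module.Dual ℝ a → g), (∀ α ∈ s, α ∈ T) ∧
      (∀ α ∈ s, x α ∈ rootSpace a α) ∧ X = ∑ α ∈ s, x α := by
  obtain ⟨f, hf, rfl⟩ := (Submodule.mem_iSup_iff_exists_finsupp _ _).mp hX
  refine ⟨f.support, f, fun α hα => ?_, fun α _ => ?_, rfl⟩
  · by_contra h
    have := hf α
    simp only [h, iSup_false, Submodule.mem_bot] at this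
    exact Finsupp.mem_support_iff.mp hα this
  · exact (iSup_le fun _ => le_rfl : (⨆ _ : α ∈ T, rootSpace a α) ≤ rootSpace a α) (hf α)

theorem eq_zero_of_mem_sumRootSpaces {T : Set (Module.Dual ℝ a)} {β : Module.Dual ℝ a}
    (hβ : β ∉ T) {X : g} (hX : X ∈ rootSpace a β) (hXT : X ∈ sumRootSpaces a T) : X = 0 := by
  classical
  obtain ⟨s, x, hs, hx, rfl⟩ := exists_components hXT
  have hβs : β ∉ s := fun h => hβ (hs β h)
  set Y := ∑ α ∈ s, x α with hY
  -- Directness of the sum is the case `W = ⊥`, applied to the relation `-Y + ∑ x α = 0`.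
  have h := component_mem (a := a) (W := ⊥) (by simp) (insert β s) (Function.update x β (-Y))
    (fun α hα => by
      rcases eq_or_ne α β with rfl | hne
      · simpa using hX
      · simpa [hne] using hx α (Finset.mem_of_mem_insert_of_ne hα hne)) (by
      rw [Finset.sum_insert hβs, Finset.sum_congr rfl fun α hα =>
        Function.update_of_ne (ne_of_mem_of_not_mem hα hβs) (-Y) x, ← hY]
      simp) β (Finset.mem_insert_self _ _)
  simpa using h

theorem roots_finite [FiniteDimensional ℝ g] (a : Submodule ℝ g) : (roots a).Finite := by
  have h : iSupIndep (rootSpace a) := by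
    intro α
    rw [Submodule.disjoint_def]
    intro X hX hX'
    exact eq_zero_of_mem_sumRootSpaces (T := {β | β ≠ α}) (by simp) hX hX'
  exact (WellFoundedGT.finite_ne_bot_of_iSupIndep h).subset fun α hα => hα.2

end Components

/-! ### Nonvanishing brackets and root strings -/

section RootStrings

variable {g : Type*} [LieRing g] [LieAlgebra ℝ g] {a : Submodule ℝ g} {θ : g ≃ₗ⁅ℝ⁆ g}

/-- `G` is an inner product on the dual of `a` adapted to the norms of brackets of root vectors. -/
structure IsDualForm (θ : g ≃ₗ⁅ℝ⁆ g) (G : LinearMap.BilinForm ℝ (Module.Dual ℝ a)) : Prop where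
  symm : ∀ α β, G α β = G β α
  pos : ∀ α, α ≠ 0 → 0 < G α α
  normSq_lie : ∀ α β : Module.Dual ℝ a, ∀ E ∈ rootSpace a α, ∀ Y ∈ rootSpace a β,
    normSq θ ⁅E, Y⁆ = normSq θ ⁅θ E, Y⁆ - normSq θ E * G α β * normSq θ Y

variable {G : LinearMap.BilinForm ℝ (Module.Dual ℝ a)}

theorem lie_ne_zero_of_neg (hθ : IsCartanInvolution θ) (hG : IsDualForm θ G)
    {α β : Module.Dual ℝ a} {E Y : g} (hE : E ∈ rootSpace a α) (hE0 : E ≠ 0)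
    (hY : Y ∈ rootSpace a β) (hY0 : Y ≠ 0) (h : G α β < 0) : ⁅E, Y⁆ ≠ 0 := by
  intro h0
  have h1 := hG.normSq_lie α β E hE Y hY
  rw [h0, normSq_zero] at h1
  have h2 := mul_pos (mul_pos (hθ.normSq_pos hE0) (neg_pos.mpr h)) (hθ.normSq_pos hY0)
  have h3 := hθ.normSq_nonneg ⁅θ E, Y⁆
  linarith

theorem lie_map_ne_zero_of_pos (hθ : IsCartanInvolution θ) (hG : IsDualForm θ G)
    {α β : Module.Dual ℝ a} {E Y : g} (hE : E ∈ rootSpace a α) (hE0 : E ≠ 0)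
    (hY : Y ∈ rootSpace a β) (hY0 : Y ≠ 0) (h : 0 < G α β) : ⁅θ E, Y⁆ ≠ 0 := by
  intro h0
  have h1 := hG.normSq_lie α β E hE Y hY
  rw [h0, normSq_zero] at h1
  have h2 := mul_pos (mul_pos (hθ.normSq_pos hE0) h) (hθ.normSq_pos hY0)
  have h3 := hθ.normSq_nonneg ⁅E, Y⁆
  linarith

/-- `ad E` is injective on the image of `ad (θ E)`. -/
theorem lie_map_eq_zero_of_lie_lie (hθ : IsCartanInvolution θ) {E Y : g}
    (h : ⁅E, ⁅θ E, Y⁆⁆ = 0) : ⁅θ E, Y⁆ = 0 := by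
  -- Applying `θ` gives `[θ E, [E, θ Y]] = 0`, the vector paired with `Y` when `normSq_lie`
  -- expresses the norm of `[θ E, Y]`.
  have h' := congrArg θ h
  rw [LieEquiv.map_lie, LieEquiv.map_lie, hθ.involutive, map_zero] at h'
  rw [← hθ.normSq_eq_zero, normSq_lie, hθ.involutive, h', map_zero]

/-- If `⟨α, β⟩ < 0`, any nonzero `Y` serves. Otherwise `⟨α, α + β⟩ > 0`, so lowering a vector of
`g_{α+β}` by `θ E` gives a nonzero vector, and `ad E` is injective on the image of `ad (θ E)`. -/
theorem exists_lie_ne_zero (hθ : IsCartanInvolution θ) (ha : IsMaximalAbelian θ a)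
    (hG : IsDualForm θ G) {α β : Module.Dual ℝ a} (hα : α ∈ roots a)
    (hβ : rootSpace a β ≠ ⊥) (hαβ : rootSpace a (α + β) ≠ ⊥) {E : g} (hE : E ∈ rootSpace a α)
    (hE0 : E ≠ 0) : ∃ Y ∈ rootSpace a β, ⁅E, Y⁆ ≠ 0 := by
  obtain ⟨Y, hY, hY0⟩ := Submodule.exists_mem_ne_zero_of_ne_bot hβ
  obtain ⟨Z, hZ, hZ0⟩ := Submodule.exists_mem_ne_zero_of_ne_bot hαβ
  rcases lt_or_ge (G α β) 0 with h | h
  · exact ⟨Y, hY, lie_ne_zero_of_neg hθ hG hE hE0 hY hY0 h⟩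
  · have h' : 0 < G α (α + β) := by
      rw [map_add]
      have := hG.pos α hα.1
      linarith
    refine ⟨⁅θ E, Z⁆, ?_, fun h0 => ?_⟩
    · simpa using lie_mem_rootSpace (map_mem_rootSpace_neg ha hE) hZ
    · exact lie_map_ne_zero_of_pos hθ hG hE hE0 hZ hZ0 h' (lie_map_eq_zero_of_lie_lie hθ h0)

theorem rootSpace_sub_ne_bot (hθ : IsCartanInvolution θ) (ha : IsMaximalAbelian θ a)
    (hG : IsDualForm θ G) {α β : Module.Dual ℝ a} (hα : rootSpace a α ≠ ⊥)
    (hβ : rootSpace a β ≠ ⊥) (h : 0 < G α β) : rootSpace a (β - α) ≠ ⊥ := by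
  obtain ⟨E, hE, hE0⟩ := Submodule.exists_mem_ne_zero_of_ne_bot hα
  obtain ⟨Y, hY, hY0⟩ := Submodule.exists_mem_ne_zero_of_ne_bot hβ
  refine (Submodule.ne_bot_iff _).mpr
    ⟨⁅θ E, Y⁆, ?_, lie_map_ne_zero_of_pos hθ hG hE hE0 hY hY0 h⟩
  rw [sub_eq_neg_add]
  exact lie_mem_rootSpace (map_mem_rootSpace_neg ha hE) hY

theorem rootSpace_add_ne_bot (hθ : IsCartanInvolution θ)
    (hG : IsDualForm θ G) {α β : Module.Dual ℝ a} (hα : rootSpace a α ≠ ⊥)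
    (hβ : rootSpace a β ≠ ⊥) (h : G α β < 0) : rootSpace a (α + β) ≠ ⊥ := by
  obtain ⟨E, hE, hE0⟩ := Submodule.exists_mem_ne_zero_of_ne_bot hα
  obtain ⟨Y, hY, hY0⟩ := Submodule.exists_mem_ne_zero_of_ne_bot hβ
  exact (Submodule.ne_bot_iff _).mpr
    ⟨⁅E, Y⁆, lie_mem_rootSpace hE hY, lie_ne_zero_of_neg hθ hG hE hE0 hY hY0 h⟩

/-- At the bottom of an `α`-string that does not stop there, the pairing is negative. -/
theorem dualForm_neg_of_string (hθ : IsCartanInvolution θ) (ha : IsMaximalAbelian θ a)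
    (hG : IsDualForm θ G) {α β : Module.Dual ℝ a} (hα : α ∈ roots a)
    (hβ : rootSpace a β ≠ ⊥) (hαβ : rootSpace a (α + β) ≠ ⊥) (hsub : rootSpace a (β - α) = ⊥) :
    G α β < 0 := by
  obtain ⟨E, hE, hE0⟩ := Submodule.exists_mem_ne_zero_of_ne_bot hα.2
  obtain ⟨Y, hY, hY0⟩ := exists_lie_ne_zero hθ ha hG hα hβ hαβ hE hE0
  have h0 : ⁅θ E, Y⁆ = 0 := by
    rw [← Submodule.mem_bot ℝ, ← hsub, sub_eq_neg_add]
    exact lie_mem_rootSpace (map_mem_rootSpace_neg ha hE) hY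
  have hY1 : Y ≠ 0 := by
    rintro rfl
    exact hY0 (lie_zero E)
  have h1 := hG.normSq_lie α β E hE Y hY
  rw [h0, normSq_zero] at h1
  have h2 := hθ.normSq_pos hY0
  by_contra! h3
  have h4 := mul_nonneg (mul_nonneg (hθ.normSq_nonneg E) h3) (hθ.normSq_nonneg Y)
  linarith

theorem neg_mem_roots (ha : IsMaximalAbelian θ a)
    {α : Module.Dual ℝ a} (hα : α ∈ roots a) : -α ∈ roots a := by
  obtain ⟨E, hE, hE0⟩ := Submodule.exists_mem_ne_zero_of_ne_bot hα.2
  exact ⟨neg_ne_zero.mpr hα.1, (Submodule.ne_bot_iff _).mpr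
    ⟨θ E, map_mem_rootSpace_neg ha hE, fun h => hE0 (by simpa using congrArg θ.symm h)⟩⟩

end RootStrings

end HessenbergLie

namespace HessenbergLie

/-! ### Obtuse families of positive vectors -/

section Positivity

variable {V : Type*} [AddCommGroup V] [Module ℝ V] {P : Set V}

theorem IsPositivity.ne_zero (hP : IsPositivity P) {v : V} (hv : v ∈ P) : v ≠ 0 := by
  rintro rfl
  exact hP.zero_notMem hv

theorem IsPositivity.isStrictOrder (hP : IsPositivity P) :
    IsStrictOrder V fun v w => w - v ∈ P where
  irrefl v h := hP.zero_notMem (by simpa using h)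
  trans u v w h h' := by simpa using hP.add_mem _ h' _ h

theorem IsPositivity.sum_ne_zero (hP : IsPositivity P) {ι : Type*} {v : ι → V}
    (hv : ∀ i, v i ∈ P) {s : Finset ι} (hs : s.Nonempty) {c : ι → ℝ} (hc : ∀ i ∈ s, 0 < c i) :
    ∑ i ∈ s, c i • v i ≠ 0 :=
  hP.ne_zero <| Finset.sum_induction_nonempty _ (· ∈ P) (fun v w hv hw => hP.add_mem v hv w hw) hs
    fun i hi => hP.smul_mem _ (hc i hi) _ (hv i)

/-- Positive vectors at pairwise obtuse angles are linearly independent. -/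
theorem IsPositivity.linearIndependent (hP : IsPositivity P) (G : LinearMap.BilinForm ℝ V)
    (hG : ∀ v, v ≠ 0 → 0 < G v v) {ι : Type*} {v : ι → V} (hv : ∀ i, v i ∈ P)
    (hvG : Pairwise fun i j => G (v i) (v j) ≤ 0) : LinearIndependent ℝ v := by
  classical
  refine linearIndependent_iff'.mpr fun s c hc => ?_
  -- The relation is split by the sign of its coefficients into `x = y`. The two index sets are
  -- disjoint, so `G x x = G x y ≤ 0` and `x = 0`, whereas a nonempty positive combination of
  -- positive vectors cannot vanish.
  set x := ∑ i ∈ s with 0 < c i, c i • v i with hx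
  set y := ∑ i ∈ s with c i < 0, (-c i) • v i with hy
  have hxy : x = y := by
    rw [← sub_eq_zero, ← hc, hx, hy, Finset.sum_filter, Finset.sum_filter,
      ← Finset.sum_sub_distrib]
    refine Finset.sum_congr rfl fun i _ => ?_
    rcases lt_trichotomy (c i) 0 with h | h | h
    · simp [h, h.not_gt]
    · simp [h]
    · simp [h, h.not_gt]
  have hle : G x y ≤ 0 := by
    rw [hx, hy]
    simp only [map_sum, LinearMap.sum_apply, map_smul, LinearMap.smul_apply, smul_eq_mul]
    refine Finset.sum_nonpos fun i hi => mul_nonpos_of_nonneg_of_nonpos ?_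
      (Finset.sum_nonpos fun j hj => mul_nonpos_of_nonneg_of_nonpos ?_ (hvG ?_))
    · exact (neg_pos.mpr (Finset.mem_filter.mp hi).2).le
    · exact (Finset.mem_filter.mp hj).2.le
    · rintro rfl
      exact (Finset.mem_filter.mp hi).2.not_gt (Finset.mem_filter.mp hj).2
  have hx0 : x = 0 := by
    by_contra h
    have := hG x h
    rw [← hxy] at hle
    linarith
  intro i hi
  by_contra h
  rcases lt_or_gt_of_ne h with h | h
  · exact hP.sum_ne_zero (c := fun i => -c i) hv ⟨i, Finset.mem_filter.mpr ⟨hi, h⟩⟩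
      (fun j hj => neg_pos.mpr (Finset.mem_filter.mp hj).2) (hxy.symm.trans hx0)
  · exact hP.sum_ne_zero hv ⟨i, Finset.mem_filter.mpr ⟨hi, h⟩⟩
      (fun j hj => (Finset.mem_filter.mp hj).2) hx0

end Positivity

/-! ### Simple roots, expansions and supports -/

section SimpleRoots

variable {g : Type*} [LieRing g] [LieAlgebra ℝ g] {a : Submodule ℝ g} {θ : g ≃ₗ⁅ℝ⁆ g}
  {P : Set (Module.Dual ℝ a)} {G : LinearMap.BilinForm ℝ (Module.Dual ℝ a)}

theorem sub_notMem_of_simple {α δ : Module.Dual ℝ a} (hδ : δ ∈ simpleRoots a P)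
    (hα : α ∈ posRoots a P) : δ - α ∉ posRoots a P := fun h =>
  hδ.2 α hα _ h (by abel)

theorem sub_mem_posRoots (hP : IsPositivity P) (ha : IsMaximalAbelian θ a)
    {α δ : Module.Dual ℝ a} (hδ : δ ∈ simpleRoots a P) (hα : α ∈ posRoots a P) (hne : α ≠ δ)
    (h : rootSpace a (α - δ) ≠ ⊥) : α - δ ∈ posRoots a P := by
  have hr : α - δ ∈ roots a := ⟨sub_ne_zero.mpr hne, h⟩
  refine ⟨hr, (hP.mem_or_neg_mem _ hr.1).resolve_right fun hneg => ?_⟩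
  have hr' := neg_mem_roots ha hr
  rw [neg_sub] at hneg hr'
  exact sub_notMem_of_simple hδ hα ⟨hr', hneg⟩

/-- A positive pairing would make `δ' - δ` a root; whichever of it and its negative is positive
would decompose a simple root. -/
theorem dualForm_simple_nonpos (hP : IsPositivity P) (hθ : IsCartanInvolution θ)
    (ha : IsMaximalAbelian θ a) (hG : IsDualForm θ G) {δ δ' : Module.Dual ℝ a}
    (hδ : δ ∈ simpleRoots a P) (hδ' : δ' ∈ simpleRoots a P) (hne : δ ≠ δ') : G δ δ' ≤ 0 := by
  by_contra! h
  exact sub_notMem_of_simple hδ' hδ.1 (sub_mem_posRoots hP ha hδ hδ'.1 hne.symm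
    (rootSpace_sub_ne_bot hθ ha hG hδ.1.1.2 hδ'.1.1.2 h))

theorem simpleRoots_linearIndependent (hP : IsPositivity P) (hθ : IsCartanInvolution θ)
    (ha : IsMaximalAbelian θ a) (hG : IsDualForm θ G) :
    LinearIndependent ℤ (Subtype.val : simpleRoots a P → Module.Dual ℝ a) := by
  have h : LinearIndependent ℝ (Subtype.val : simpleRoots a P → Module.Dual ℝ a) :=
    hP.linearIndependent G hG.pos (fun δ => δ.2.1.2) fun δ δ' hne =>
      dualForm_simple_nonpos hP hθ ha hG δ.2 δ'.2 (Subtype.coe_injective.ne hne)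
  exact h.restrict_scalars' ℤ

theorem isExpansion_iff {α : Module.Dual ℝ a} {n : simpleRoots a P →₀ ℤ} :
    IsExpansion a P α n ↔ Finsupp.linearCombination ℤ Subtype.val n = α :=
  eq_comm

theorem IsExpansion.add {α β : Module.Dual ℝ a} {m n : simpleRoots a P →₀ ℤ}
    (hm : IsExpansion a P α m) (hn : IsExpansion a P β n) : IsExpansion a P (α + β) (m + n) := by
  rw [isExpansion_iff] at *
  rw [map_add, hm, hn]

theorem isExpansion_single (δ : simpleRoots a P) :
    IsExpansion a P (δ : Module.Dual ℝ a) (Finsupp.single δ 1) := by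
  rw [isExpansion_iff, Finsupp.linearCombination_single, one_smul]

theorem IsExpansion.unique
    (hli : LinearIndependent ℤ (Subtype.val : simpleRoots a P → Module.Dual ℝ a))
    {α : Module.Dual ℝ a} {m n : simpleRoots a P →₀ ℤ}
    (hm : IsExpansion a P α m) (hn : IsExpansion a P α n) : m = n := by
  rw [isExpansion_iff] at hm hn
  exact hli (hm.trans hn.symm)

theorem IsExpansion.mem_simpleSupport_iff
    (hli : LinearIndependent ℤ (Subtype.val : simpleRoots a P → Module.Dual ℝ a))
    {α : Module.Dual ℝ a} {n : simpleRoots a P →₀ ℤ} (hn : IsExpansion a P α n)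
    (δ : simpleRoots a P) : (δ : Module.Dual ℝ a) ∈ simpleSupport a P α ↔ n δ ≠ 0 := by
  refine ⟨fun ⟨hδ, m, hm, hm0⟩ => ?_, fun h => ⟨δ.2, n, hn, h⟩⟩
  rwa [hm.unique hli hn] at hm0

theorem simpleSupport_simple
    (hli : LinearIndependent ℤ (Subtype.val : simpleRoots a P → Module.Dual ℝ a))
    {δ : Module.Dual ℝ a} (hδ : δ ∈ simpleRoots a P) : simpleSupport a P δ = {δ} := by
  classical
  ext δ'
  rw [Set.mem_singleton_iff]
  by_cases hδ' : δ' ∈ simpleRoots a P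
  · rw [(isExpansion_single ⟨δ, hδ⟩).mem_simpleSupport_iff hli ⟨δ', hδ'⟩, Finsupp.single_apply]
    simp [eq_comm]
  · refine ⟨fun h => absurd h.1 hδ', ?_⟩
    rintro rfl
    exact absurd hδ hδ'

theorem posRoots_wellFoundedOn [FiniteDimensional ℝ g] (hP : IsPositivity P) :
    (posRoots a P).WellFoundedOn fun v w => w - v ∈ P :=
  have := hP.isStrictOrder
  ((roots_finite a).subset fun _ h => h.1).wellFoundedOn

/-- Every positive root is obtained from simple roots by successive sums inside `Σ₊`. -/
theorem posRoots_induction [FiniteDimensional ℝ g] (hP : IsPositivity P)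
    {p : Module.Dual ℝ a → Prop} (hsimple : ∀ δ ∈ simpleRoots a P, p δ)
    (hadd : ∀ β ∈ posRoots a P, ∀ γ ∈ posRoots a P, β + γ ∈ posRoots a P → p β → p γ → p (β + γ))
    {α : Module.Dual ℝ a} (hα : α ∈ posRoots a P) : p α := by
  refine (posRoots_wellFoundedOn hP).induction hα fun α hα ih => ?_
  by_cases h : α ∈ simpleRoots a P
  · exact hsimple α h
  · have h' : ¬ ∀ β ∈ posRoots a P, ∀ γ ∈ posRoots a P, α ≠ β + γ := fun h' => h ⟨hα, h'⟩
    push Not at h'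
    obtain ⟨β, hβ, γ, hγ, rfl⟩ := h'
    exact hadd β hβ γ hγ hα (ih β hβ (by simpa using hγ.2)) (ih γ hγ (by simpa using hβ.2))

theorem exists_nonneg_isExpansion [FiniteDimensional ℝ g] (hP : IsPositivity P)
    {α : Module.Dual ℝ a} (hα : α ∈ posRoots a P) :
    ∃ n : simpleRoots a P →₀ ℤ, IsExpansion a P α n ∧ ∀ δ, 0 ≤ n δ := by
  classical
  refine posRoots_induction hP (p := fun α => ∃ n : simpleRoots a P →₀ ℤ,
    IsExpansion a P α n ∧ ∀ δ, 0 ≤ n δ) (fun δ hδ => ?_) (fun β _ γ _ _ => ?_) hα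
  · refine ⟨_, isExpansion_single ⟨δ, hδ⟩, fun δ' => ?_⟩
    rw [Finsupp.single_apply]
    split_ifs <;> simp
  · rintro ⟨m, hm, hm0⟩ ⟨n, hn, hn0⟩
    exact ⟨m + n, hm.add hn, fun δ => add_nonneg (hm0 δ) (hn0 δ)⟩

theorem simpleSupport_add [FiniteDimensional ℝ g] (hP : IsPositivity P)
    (hli : LinearIndependent ℤ (Subtype.val : simpleRoots a P → Module.Dual ℝ a))
    {β γ : Module.Dual ℝ a} (hβ : β ∈ posRoots a P) (hγ : γ ∈ posRoots a P) :
    simpleSupport a P (β + γ) = simpleSupport a P β ∪ simpleSupport a P γ := by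
  obtain ⟨m, hm, hm0⟩ := exists_nonneg_isExpansion hP hβ
  obtain ⟨n, hn, hn0⟩ := exists_nonneg_isExpansion hP hγ
  ext δ
  by_cases hδ : δ ∈ simpleRoots a P
  · rw [Set.mem_union, (hm.add hn).mem_simpleSupport_iff hli ⟨δ, hδ⟩,
      hm.mem_simpleSupport_iff hli ⟨δ, hδ⟩, hn.mem_simpleSupport_iff hli ⟨δ, hδ⟩,
      Finsupp.add_apply]
    have := hm0 ⟨δ, hδ⟩
    have := hn0 ⟨δ, hδ⟩
    omega
  · exact ⟨fun h => absurd h.1 hδ, fun h => h.elim (fun h => absurd h.1 hδ) fun h => absurd h.1 hδ⟩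

/-- No `δ`-string through a positive root `γ` continues below `γ` if `δ` is a simple root outside
the support of `γ`. -/
theorem rootSpace_sub_simple_eq_bot [FiniteDimensional ℝ g] (hP : IsPositivity P)
    (ha : IsMaximalAbelian θ a)
    (hli : LinearIndependent ℤ (Subtype.val : simpleRoots a P → Module.Dual ℝ a))
    {γ δ : Module.Dual ℝ a} (hγ : γ ∈ posRoots a P) (hδ : δ ∈ simpleRoots a P)
    (h : δ ∉ simpleSupport a P γ) : rootSpace a (γ - δ) = ⊥ := by
  have hδδ : δ ∈ simpleSupport a P δ := by rw [simpleSupport_simple hli hδ]; rfl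
  by_contra hbot
  have hne : γ ≠ δ := by
    rintro rfl
    exact h hδδ
  have hmem := sub_mem_posRoots hP ha hδ hγ hne hbot
  have hY := simpleSupport_add hP hli hmem hδ.1
  rw [sub_add_cancel] at hY
  exact h (hY ▸ Or.inr hδδ)

theorem IsExpansion.dualForm_apply {ν : Module.Dual ℝ a} {n : simpleRoots a P →₀ ℤ}
    (hn : IsExpansion a P ν n) (δ : Module.Dual ℝ a) :
    G δ ν = ∑ δ' ∈ n.support, (n δ' : ℝ) * G δ δ' := by
  have h : ν = ∑ δ' ∈ n.support, n δ' • (δ' : Module.Dual ℝ a) := hn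
  conv_lhs => rw [h]
  simp [map_sum]

/-- Adding a simple root outside the support of `ν` gives a root if and only if it is adjacent to
that support. -/
theorem add_mem_roots_iff [FiniteDimensional ℝ g] (hP : IsPositivity P)
    (hθ : IsCartanInvolution θ) (ha : IsMaximalAbelian θ a) (hG : IsDualForm θ G)
    {ν δ : Module.Dual ℝ a} (hν : ν ∈ posRoots a P) (hδ : δ ∈ simpleRoots a P)
    (h : δ ∉ simpleSupport a P ν) :
    δ + ν ∈ roots a ↔ ∃ δ' ∈ simpleSupport a P ν, δ + δ' ∈ roots a := by
  have hli := simpleRoots_linearIndependent hP hθ ha hG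
  obtain ⟨n, hn, hn0⟩ := exists_nonneg_isExpansion hP hν
  -- `G δ ν` is a sum of nonpositive terms `n δ' * G δ δ'`, hence negative exactly when one term is.
  -- Neither `ν - δ` nor `δ' - δ` has a nonzero root space, so these signs decide whether `δ + ν`
  -- and `δ + δ'` are roots.
  have hterm : ∀ δ' ∈ n.support, (n δ' : ℝ) * G δ δ' ≤ 0 := by
    intro δ' hδ'
    refine mul_nonpos_of_nonneg_of_nonpos (by exact_mod_cast hn0 δ') ?_
    refine dualForm_simple_nonpos hP hθ ha hG hδ δ'.2 ?_
    rintro rfl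
    exact h ((hn.mem_simpleSupport_iff hli δ').mpr (Finsupp.mem_support_iff.mp hδ'))
  have hne : ∀ β, β ∈ posRoots a P → δ + β ≠ 0 := fun β hβ =>
    hP.ne_zero (hP.add_mem _ hδ.1.2 _ hβ.2)
  constructor
  · intro hr
    have hneg := dualForm_neg_of_string hθ ha hG hδ.1.1 hν.1.2 hr.2
      (rootSpace_sub_simple_eq_bot hP ha hli hν hδ h)
    rw [hn.dualForm_apply] at hneg
    obtain ⟨δ', hδ', hlt⟩ : ∃ δ' ∈ n.support, (n δ' : ℝ) * G δ δ' < 0 := by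
      by_contra! hge
      exact (Finset.sum_nonneg hge).not_gt hneg
    refine ⟨δ', (hn.mem_simpleSupport_iff hli δ').mpr (Finsupp.mem_support_iff.mp hδ'),
      hne _ δ'.2.1, rootSpace_add_ne_bot hθ hG hδ.1.1.2 δ'.2.1.1.2 ?_⟩
    by_contra! hge
    exact (mul_nonneg (by exact_mod_cast hn0 δ') hge).not_gt hlt
  · rintro ⟨δ', hδ', hr⟩
    have hn' := (hn.mem_simpleSupport_iff hli ⟨δ', hδ'.1⟩).mp hδ'
    have hneδ : δ ≠ δ' := by
      rintro rfl
      exact h hδ'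
    have hneg := dualForm_neg_of_string hθ ha hG hδ.1.1 hδ'.1.1.1.2 hr.2
      (rootSpace_sub_simple_eq_bot hP ha hli hδ'.1.1 hδ
        (by rwa [simpleSupport_simple hli hδ'.1]))
    refine ⟨hne _ hν, rootSpace_add_ne_bot hθ hG hδ.1.1.2 hν.1.2 ?_⟩
    rw [hn.dualForm_apply]
    refine Finset.sum_neg' hterm ⟨⟨δ', hδ'.1⟩, Finsupp.mem_support_iff.mpr hn', ?_⟩
    exact mul_neg_of_pos_of_neg
      (by exact_mod_cast lt_of_le_of_ne (hn0 _) hn'.symm) hneg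

end SimpleRoots

end HessenbergLie

namespace HessenbergLie

/-! ### Root spaces in the normalizer and boundary simple roots -/

section Normalizer

variable {g : Type*} [LieRing g] [LieAlgebra ℝ g] {a : Submodule ℝ g} {θ : g ≃ₗ⁅ℝ⁆ g}
  {P R : Set (Module.Dual ℝ a)} {G : LinearMap.BilinForm ℝ (Module.Dual ℝ a)}

theorem mem_normalizer_sumRootSpaces {T : Set (Module.Dual ℝ a)} {X : g} :
    X ∈ normalizer (sumRootSpaces a T) ↔
      ∀ γ ∈ T, ∀ Y ∈ rootSpace a γ, ⁅X, Y⁆ ∈ sumRootSpaces a T := by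
  refine ⟨fun h γ hγ Y hY => h Y (rootSpace_le_sumRootSpaces hγ hY), fun h Y hY => ?_⟩
  obtain ⟨s, x, hs, hx, rfl⟩ := exists_components hY
  rw [lie_sum]
  exact Submodule.sum_mem _ fun γ hγ => h γ (hs γ hγ) _ (hx γ hγ)

theorem rootSpace_zero_le_normalizer (T : Set (Module.Dual ℝ a)) :
    rootSpace a 0 ≤ (normalizer (sumRootSpaces a T)).toSubmodule := by
  intro X hX
  refine mem_normalizer_sumRootSpaces.mpr fun γ hγ Y hY => rootSpace_le_sumRootSpaces hγ ?_
  simpa using lie_mem_rootSpace hX hY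

theorem le_rootSpace_zero (ha : IsMaximalAbelian θ a) : a ≤ rootSpace a 0 := by
  intro X hX H
  rw [ha.abelian H H.2 X hX, LinearMap.zero_apply, zero_smul]

theorem normalizer_adStable (ha : IsMaximalAbelian θ a) (T : Set (Module.Dual ℝ a)) :
    ∀ H ∈ a, ∀ X ∈ (normalizer (sumRootSpaces a T)).toSubmodule,
      ⁅H, X⁆ ∈ (normalizer (sumRootSpaces a T)).toSubmodule := fun _ hH _ hX =>
  (normalizer (sumRootSpaces a T)).lie_mem
    (rootSpace_zero_le_normalizer T (le_rootSpace_zero ha hH)) hX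

theorem neg_mem_negRoots (ha : IsMaximalAbelian θ a) {α : Module.Dual ℝ a}
    (hα : α ∈ posRoots a P) : -α ∈ negRoots a P :=
  ⟨neg_mem_roots ha hα.1, by simpa using hα.2⟩

theorem neg_mem_posRoots (ha : IsMaximalAbelian θ a) {α : Module.Dual ℝ a}
    (hα : α ∈ negRoots a P) : -α ∈ posRoots a P :=
  ⟨neg_mem_roots ha hα.1, hα.2⟩

/-- `n_C` is an ideal of `n`. -/
theorem rootSpace_pos_le_normalizer (hP : IsPositivity P) (ha : IsMaximalAbelian θ a)
    (hR : IsHessenberg a P R) {β : Module.Dual ℝ a} (hβ : β ∈ posRoots a P) :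
    rootSpace a β ≤ (normalizer (complementIdeal a P R)).toSubmodule := by
  intro X hX
  refine mem_normalizer_sumRootSpaces.mpr fun γ hγ Y hY => ?_
  have hXY := lie_mem_rootSpace hX hY
  by_cases h0 : ⁅X, Y⁆ = 0
  · rw [h0]
    exact Submodule.zero_mem _
  have hmem : β + γ ∈ P := hP.add_mem _ hβ.2 _ hγ.1.2
  refine rootSpace_le_sumRootSpaces (T := posRoots a P \ R) ⟨⟨⟨hP.ne_zero hmem, ?_⟩, hmem⟩, fun hRmem => ?_⟩ hXY
  · exact (Submodule.ne_bot_iff _).mpr ⟨_, hXY, h0⟩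
  · refine hγ.2 ?_
    have h := hR.add_mem _ hRmem _ (neg_mem_negRoots ha hβ)
    rw [add_neg_cancel_comm] at h
    exact h hγ.1

theorem oppNilradical_eq (hθ : IsCartanInvolution θ) (ha : IsMaximalAbelian θ a) :
    oppNilradical θ a P = sumRootSpaces a (negRoots a P) := by
  refine le_antisymm ?_ (iSup₂_le fun α hα X hX => ?_)
  · rw [oppNilradical, Submodule.map_le_iff_le_comap]
    refine iSup₂_le fun α hα X hX => ?_
    exact rootSpace_le_sumRootSpaces (neg_mem_negRoots ha hα) (map_mem_rootSpace_neg ha hX)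
  · exact ⟨θ X, rootSpace_le_sumRootSpaces (neg_mem_posRoots ha hα) (map_mem_rootSpace_neg ha hX),
      hθ.involutive X⟩

theorem IsNormalizerRootSet.neg_mem_iff (hθ : IsCartanInvolution θ) (ha : IsMaximalAbelian θ a)
    {D : Set (Module.Dual ℝ a)} (hD : IsNormalizerRootSet θ a P R D) {α : Module.Dual ℝ a}
    (hα : α ∈ posRoots a P) :
    -α ∈ D ↔ rootSpace a (-α) ≤ (normalizer (complementIdeal a P R)).toSubmodule := by
  refine ⟨fun h => (rootSpace_le_sumRootSpaces h).trans (hD.2.symm.le.trans inf_le_left),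
    fun h => ?_⟩
  by_contra hnot
  obtain ⟨X, hX, hX0⟩ := Submodule.exists_mem_ne_zero_of_ne_bot (neg_mem_roots ha hα.1).2
  refine hX0 (eq_zero_of_mem_sumRootSpaces hnot hX ?_)
  rw [← hD.2, oppNilradical_eq hθ ha]
  exact ⟨h hX, rootSpace_le_sumRootSpaces (neg_mem_negRoots ha hα) hX⟩

/-- `g_{-δ}` normalizes `n_C` if and only if no root of `R` leaves `R` by adding the simple
root `δ`. -/
theorem not_rootSpace_neg_simple_le_iff (hP : IsPositivity P) (hθ : IsCartanInvolution θ)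
    (ha : IsMaximalAbelian θ a) (hG : IsDualForm θ G) (hsimple : simpleRoots a P ⊆ R)
    {δ : Module.Dual ℝ a} (hδ : δ ∈ simpleRoots a P) :
    ¬ rootSpace a (-δ) ≤ (normalizer (complementIdeal a P R)).toSubmodule ↔
      ∃ γ ∈ posRoots a P, γ ∈ R ∧ δ + γ ∈ posRoots a P \ R := by
  constructor
  · intro h
    obtain ⟨X, hX, hXq⟩ := SetLike.not_le_iff_exists.mp h
    obtain ⟨γ, hγ, Y, hY, hXY⟩ : ∃ γ ∈ posRoots a P \ R, ∃ Y ∈ rootSpace a γ,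
        ⁅X, Y⁆ ∉ complementIdeal a P R := by
      by_contra! h'
      exact hXq (mem_normalizer_sumRootSpaces.mpr h')
    have hmem := lie_mem_rootSpace hX hY
    rw [neg_add_eq_sub] at hmem
    -- `γ ≠ δ` because simple roots lie in `R` while `γ` does not; this keeps `γ - δ` from being
    -- zero.
    have hpos := sub_mem_posRoots hP ha hδ hγ.1 (fun h => hγ.2 (h ▸ hsimple hδ))
      ((Submodule.ne_bot_iff _).mpr
        ⟨_, hmem, fun h => hXY (by rw [h]; exact Submodule.zero_mem _)⟩)
    refine ⟨γ - δ, hpos, ?_, by rwa [add_sub_cancel]⟩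
    by_contra hnot
    exact hXY (rootSpace_le_sumRootSpaces (T := posRoots a P \ R) ⟨hpos, hnot⟩ hmem)
  · rintro ⟨γ, hγ, hγR, hδγ⟩ h
    have hδ' := neg_mem_roots ha hδ.1.1
    have hsum : -δ + (δ + γ) = γ := by abel
    obtain ⟨E, hE, hE0⟩ := Submodule.exists_mem_ne_zero_of_ne_bot hδ'.2
    obtain ⟨Y, hY, hY0⟩ := exists_lie_ne_zero hθ ha hG hδ' hδγ.1.1.2
      (by rw [hsum]; exact hγ.1.2) hE hE0
    exact hY0 (eq_zero_of_mem_sumRootSpaces (fun h => h.2 hγR)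
      (hsum ▸ lie_mem_rootSpace hE hY) (h hE Y (rootSpace_le_sumRootSpaces hδγ hY)))

variable [FiniteDimensional ℝ g]

/-- The centralizer of `a` acts on each restricted root space without proper invariant
subspaces. -/
theorem rootSpace_le_of_mem (hθ : IsCartanInvolution θ) (ha : IsMaximalAbelian θ a)
    (hG : IsDualForm θ G) {q : LieSubalgebra ℝ g} (hq : rootSpace a 0 ≤ q.toSubmodule)
    {α : Module.Dual ℝ a} (hα : α ≠ 0) {X : g} (hX : X ∈ rootSpace a α) (hXq : X ∈ q)
    (hX0 : X ≠ 0) : rootSpace a α ≤ q.toSubmodule := by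
  have hθX := map_mem_rootSpace_neg ha hX
  have hθX0 : θ X ≠ 0 := fun h => hX0 (by simpa using congrArg θ.symm h)
  have hzero : ∀ Y ∈ rootSpace a α, ⁅θ X, Y⁆ ∈ rootSpace a 0 := fun Y hY => by
    simpa using lie_mem_rootSpace hθX hY
  have hmaps : ∀ Y ∈ rootSpace a α,
      (LieAlgebra.ad ℝ g X ∘ₗ LieAlgebra.ad ℝ g (θ X)) Y ∈ rootSpace a α := fun Y hY => by
    simpa using lie_mem_rootSpace hX (hzero Y hY)
  let φ : rootSpace a α →ₗ[ℝ] rootSpace a α := LinearMap.restrict _ hmaps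
  have hφ : ∀ Y : rootSpace a α, (φ Y : g) = ⁅X, ⁅θ X, (Y : g)⁆⁆ := fun _ => rfl
  -- `ad (θ X)` is injective on `g_α` since `⟨-α, α⟩ < 0`, and `ad X` is injective on its image. In
  -- finite dimension `φ` is then onto, and its values lie in `q` because `[θ X, Y] ∈ g_0 ⊆ q`.
  have hinj : Function.Injective φ := by
    rw [injective_iff_map_eq_zero]
    intro Y hY
    by_contra hY0
    refine lie_ne_zero_of_neg hθ hG hθX hθX0 Y.2 (by simpa using hY0) ?_
      (lie_map_eq_zero_of_lie_lie hθ (by rw [← hφ, hY]; rfl))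
    rw [map_neg, LinearMap.neg_apply]
    exact neg_neg_of_pos (hG.pos α hα)
  intro Z hZ
  obtain ⟨Y, hY⟩ := LinearMap.injective_iff_surjective.mp hinj ⟨Z, hZ⟩
  have hZY : Z = ⁅X, ⁅θ X, (Y : g)⁆⁆ := by rw [← hφ, hY]
  rw [hZY]
  exact q.lie_mem hXq (hq (hzero Y Y.2))

/-- The normalizer is `ad a`-stable, so it contains the components of its elements; a nonzero
component brings in its whole root space. -/
theorem isNormalizerRootSet_setOf (hθ : IsCartanInvolution θ) (ha : IsMaximalAbelian θ a)
    (hG : IsDualForm θ G) : IsNormalizerRootSet θ a P R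
      {α | α ∈ negRoots a P ∧
        rootSpace a α ≤ (normalizer (complementIdeal a P R)).toSubmodule} := by
  refine ⟨fun α h => h.1, ?_⟩
  rw [oppNilradical_eq hθ ha]
  apply le_antisymm
  · rintro X ⟨hXq, hX⟩
    obtain ⟨s, x, hs, hx, rfl⟩ := exists_components hX
    have hxq := component_mem (normalizer_adStable ha _) s x hx hXq
    refine Submodule.sum_mem _ fun α hα => ?_
    by_cases h0 : x α = 0
    · rw [h0]
      exact Submodule.zero_mem _
    · have hle := rootSpace_le_of_mem hθ ha hG (rootSpace_zero_le_normalizer _)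
        (hs α hα).1.1 (hx α hα) (hxq α hα) h0
      exact rootSpace_le_sumRootSpaces (Set.mem_ofPred.mpr ⟨hs α hα, hle⟩) (hx α hα)
  · exact iSup₂_le fun α hα => le_inf hα.2 (rootSpace_le_sumRootSpaces hα.1)

/-- Bracketing `g_γ ⊆ n ⊆ q` with `g_{-(β+γ)} ⊆ q` produces a nonzero vector of `g_{-β}` in `q`, and
one such vector is enough. -/
theorem rootSpace_neg_le_of_add (hP : IsPositivity P) (hθ : IsCartanInvolution θ)
    (ha : IsMaximalAbelian θ a) (hG : IsDualForm θ G) (hR : IsHessenberg a P R)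
    {β γ : Module.Dual ℝ a} (hβ : β ∈ posRoots a P) (hγ : γ ∈ posRoots a P)
    (hβγ : β + γ ∈ posRoots a P)
    (h : rootSpace a (-(β + γ)) ≤ (normalizer (complementIdeal a P R)).toSubmodule) :
    rootSpace a (-β) ≤ (normalizer (complementIdeal a P R)).toSubmodule := by
  have hsum : γ + -(β + γ) = -β := by abel
  have hβ' := neg_mem_roots ha hβ.1
  obtain ⟨E, hE, hE0⟩ := Submodule.exists_mem_ne_zero_of_ne_bot hγ.1.2
  obtain ⟨Y, hY, hY0⟩ := exists_lie_ne_zero hθ ha hG hγ.1 (neg_mem_roots ha hβγ.1).2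
    (by rw [hsum]; exact hβ'.2) hE hE0
  exact rootSpace_le_of_mem hθ ha hG (rootSpace_zero_le_normalizer _) hβ'.1
    (hsum ▸ lie_mem_rootSpace hE hY)
    (LieSubalgebra.lie_mem _ (rootSpace_pos_le_normalizer hP ha hR hγ hE) (h hY)) hY0

theorem rootSpace_neg_add_le_iff (hP : IsPositivity P) (hθ : IsCartanInvolution θ)
    (ha : IsMaximalAbelian θ a) (hG : IsDualForm θ G) (hR : IsHessenberg a P R)
    {β γ : Module.Dual ℝ a} (hβ : β ∈ posRoots a P) (hγ : γ ∈ posRoots a P)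
    (hβγ : β + γ ∈ posRoots a P) :
    rootSpace a (-(β + γ)) ≤ (normalizer (complementIdeal a P R)).toSubmodule ↔
      rootSpace a (-β) ≤ (normalizer (complementIdeal a P R)).toSubmodule ∧
      rootSpace a (-γ) ≤ (normalizer (complementIdeal a P R)).toSubmodule := by
  refine ⟨fun h => ⟨rootSpace_neg_le_of_add hP hθ ha hG hR hβ hγ hβγ h,
    rootSpace_neg_le_of_add hP hθ ha hG hR hγ hβ (add_comm β γ ▸ hβγ) (add_comm β γ ▸ h)⟩, ?_⟩
  rintro ⟨h, h'⟩
  have hβγ' := neg_mem_roots ha hβγ.1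
  rw [neg_add] at hβγ' ⊢
  obtain ⟨E, hE, hE0⟩ := Submodule.exists_mem_ne_zero_of_ne_bot (neg_mem_roots ha hβ.1).2
  obtain ⟨Y, hY, hY0⟩ := exists_lie_ne_zero hθ ha hG (neg_mem_roots ha hβ.1)
    (neg_mem_roots ha hγ.1).2 hβγ'.2 hE hE0
  exact rootSpace_le_of_mem hθ ha hG (rootSpace_zero_le_normalizer _) hβγ'.1
    (lie_mem_rootSpace hE hY) (LieSubalgebra.lie_mem _ (h hE) (h' hY)) hY0

/-- Adding positive roots while staying in `R` never lowers a coefficient, and it stops because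
there are finitely many roots. -/
theorem exists_maximalRoot (hP : IsPositivity P) (hR : IsHessenberg a P R)
    {γ : Module.Dual ℝ a} (hγ : γ ∈ R) {m : simpleRoots a P →₀ ℤ} (hm : IsExpansion a P γ m) :
    ∃ ν ∈ maximalRoots a P R, ∃ n, IsExpansion a P ν n ∧ ∀ δ, m δ ≤ n δ := by
  have := hP.isStrictOrder
  have hwf : R.WellFoundedOn (Function.swap fun v w => w - v ∈ P) :=
    ((roots_finite a).subset fun _ h => (hR.subset h).1).wellFoundedOn
  refine hwf.induction hγ (P := fun γ => ∀ m, IsExpansion a P γ m → ∃ ν ∈ maximalRoots a P R,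
    ∃ n, IsExpansion a P ν n ∧ ∀ δ, m δ ≤ n δ) (fun γ hγ ih m hm => ?_) m hm
  by_cases h : ∀ α ∈ posRoots a P, γ + α ∉ R
  · exact ⟨γ, ⟨hγ, h⟩, m, hm, fun _ => le_rfl⟩
  · push Not at h
    obtain ⟨α, hα, hαR⟩ := h
    obtain ⟨k, hk, hk0⟩ := exists_nonneg_isExpansion hP hα
    obtain ⟨ν, hν, n, hn, hle⟩ := ih _ hαR (by simpa [Function.swap] using hα.2) _ (hm.add hk)
    refine ⟨ν, hν, n, hn, fun δ => le_trans ?_ (hle δ)⟩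
    simpa using hk0 δ

theorem not_rootSpace_neg_simple_le_iff_mem_boundaryRoots (hP : IsPositivity P)
    (hθ : IsCartanInvolution θ) (ha : IsMaximalAbelian θ a) (hG : IsDualForm θ G)
    (hR : IsHessenberg a P R) (hsimple : simpleRoots a P ⊆ R)
    (hshadow : ShadowsAreSubalgebras a P R) {δ : Module.Dual ℝ a} (hδ : δ ∈ simpleRoots a P) :
    ¬ rootSpace a (-δ) ≤ (normalizer (complementIdeal a P R)).toSubmodule ↔
      δ ∈ boundaryRoots a P R := by
  classical
  have hli := simpleRoots_linearIndependent hP hθ ha hG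
  rw [not_rootSpace_neg_simple_le_iff hP hθ ha hG hsimple hδ]
  constructor
  · rintro ⟨γ, hγ, hγR, hδγ⟩
    obtain ⟨m, hm, hm0⟩ := exists_nonneg_isExpansion hP hγ
    obtain ⟨ν, hν, n, hn, hle⟩ := exists_maximalRoot hP hR hγR hm
    -- Otherwise `δ` and `γ` both lie in the shadow of `ν`, whose subalgebra would contain a nonzero
    -- bracket in `g_{δ+γ}`, although `δ + γ ∉ R`.
    have hδν : δ ∉ simpleSupport a P ν := by
      intro hδν
      have hnδ := (hn.mem_simpleSupport_iff hli ⟨δ, hδ⟩).mp hδν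
      have hδS : δ ∈ shadow a P R ν := by
        refine ⟨hsimple hδ, _, n, isExpansion_single ⟨δ, hδ⟩, hn, fun δ' => ?_⟩
        have h0 := (hm0 δ').trans (hle δ')
        rw [Finsupp.single_apply]
        split_ifs with h
        · subst h
          omega
        · exact h0
      have hγS : γ ∈ shadow a P R ν := ⟨hγR, m, n, hm, hn, hle⟩
      obtain ⟨E, hE, hE0⟩ := Submodule.exists_mem_ne_zero_of_ne_bot hδ.1.1.2
      obtain ⟨Y, hY, hY0⟩ := exists_lie_ne_zero hθ ha hG hδ.1.1 hγ.1.2 hδγ.1.1.2 hE hE0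
      exact hY0 (eq_zero_of_mem_sumRootSpaces (fun h => hδγ.2 h.1) (lie_mem_rootSpace hE hY)
        (hshadow ν hν E (rootSpace_le_sumRootSpaces hδS hE) Y (rootSpace_le_sumRootSpaces hγS hY)))
    have hsub : simpleSupport a P γ ⊆ simpleSupport a P ν := by
      intro δ' hδ'
      have h1 := (hm.mem_simpleSupport_iff hli ⟨δ', hδ'.1⟩).mp hδ'
      refine (hn.mem_simpleSupport_iff hli ⟨δ', hδ'.1⟩).mpr ?_
      have := hm0 ⟨δ', hδ'.1⟩
      have := hle ⟨δ', hδ'.1⟩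
      omega
    obtain ⟨δ', hδ', hr⟩ :=
      (add_mem_roots_iff hP hθ ha hG hγ hδ fun h => hδν (hsub h)).mp hδγ.1.1
    exact ⟨hδ, ν, hν, hδν, δ', hsub hδ', hr⟩
  · rintro ⟨-, ν, hν, hδν, hadj⟩
    have hν' := hR.subset hν.1
    have hr := (add_mem_roots_iff hP hθ ha hG hν' hδ hδν).mpr hadj
    -- The maximal root is its own witness: adjacency makes `δ + ν` a root and maximality puts it
    -- outside `R`.
    exact ⟨ν, hν', hν.1, ⟨hr, hP.add_mem _ hδ.1.2 _ hν'.2⟩,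
      fun h => hν.2 δ hδ.1 (add_comm δ ν ▸ h)⟩

/-- The normalizer is determined by its simple root spaces. -/
theorem rootSpace_neg_le_iff_forall_simpleSupport (hP : IsPositivity P)
    (hθ : IsCartanInvolution θ) (ha : IsMaximalAbelian θ a) (hG : IsDualForm θ G)
    (hR : IsHessenberg a P R) {α : Module.Dual ℝ a} (hα : α ∈ posRoots a P) :
    rootSpace a (-α) ≤ (normalizer (complementIdeal a P R)).toSubmodule ↔
      ∀ δ ∈ simpleSupport a P α,
        rootSpace a (-δ) ≤ (normalizer (complementIdeal a P R)).toSubmodule := by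
  have hli := simpleRoots_linearIndependent hP hθ ha hG
  refine posRoots_induction hP (p := fun α =>
    rootSpace a (-α) ≤ (normalizer (complementIdeal a P R)).toSubmodule ↔
      ∀ δ ∈ simpleSupport a P α,
        rootSpace a (-δ) ≤ (normalizer (complementIdeal a P R)).toSubmodule)
    (fun δ hδ => by simp [simpleSupport_simple hli hδ]) (fun β hβ γ hγ hβγ ihβ ihγ => ?_) hα
  rw [rootSpace_neg_add_le_iff hP hθ ha hG hR hβ hγ hβγ, ihβ, ihγ, simpleSupport_add hP hli hβ hγ]
  simp only [Set.mem_union, or_imp, forall_and]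

end Normalizer

end HessenbergLie

open HessenbergLie in
theorem mainTheorem5 {g : Type*} [LieRing g] [LieAlgebra ℝ g] [FiniteDimensional ℝ g]
    [LieAlgebra.IsSimple ℝ g]
    (θ : g ≃ₗ⁅ℝ⁆ g) (hθ : HessenbergLie.IsCartanInvolution θ)
    (a : Submodule ℝ g) (ha : HessenbergLie.IsMaximalAbelian θ a)
    (P : Set (Module.Dual ℝ a)) (hP : HessenbergLie.IsPositivity P)
    (R : Set (Module.Dual ℝ a)) (hR : HessenbergLie.IsHessenberg a P R)
    (hsimple : HessenbergLie.simpleRoots a P ⊆ R)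
    (hshadow : HessenbergLie.ShadowsAreSubalgebras a P R) :
    (∃ D, HessenbergLie.IsNormalizerRootSet θ a P R D) ∧
    ∀ D, HessenbergLie.IsNormalizerRootSet θ a P R D →
      (∀ δ ∈ HessenbergLie.simpleRoots a P,
        -δ ∉ D ↔ δ ∈ HessenbergLie.boundaryRoots a P R) ∧
      (∀ α ∈ HessenbergLie.posRoots a P,
        -α ∉ D ↔ ∃ δ ∈ HessenbergLie.simpleSupport a P α,
          δ ∈ HessenbergLie.boundaryRoots a P R) := by
  obtain ⟨G, hsymm, hpos, hlie⟩ := exists_dualForm hθ ha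
  have hG : IsDualForm θ G := ⟨hsymm, hpos, hlie⟩
  have hbdry : ∀ δ ∈ simpleRoots a P, _ := fun δ hδ =>
    not_rootSpace_neg_simple_le_iff_mem_boundaryRoots hP hθ ha hG hR hsimple hshadow hδ
  refine ⟨⟨_, isNormalizerRootSet_setOf hθ ha hG⟩, fun D hD => ⟨fun δ hδ => ?_, fun α hα => ?_⟩⟩
  · rw [hD.neg_mem_iff hθ ha hδ.1, hbdry δ hδ]
  · rw [hD.neg_mem_iff hθ ha hα, rootSpace_neg_le_iff_forall_simpleSupport hP hθ ha hG hR hα]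
    push Not
    exact exists_congr fun δ => and_congr_right fun hδ => hbdry δ hδ.1
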